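/- **Theorem.** A bipartite graph $H=(X,Y;E)$ consists of finite disjoint vertex sets $X,Y$ and a finite multiset $E$ of edges in $X\times Y$. Let $H$ have $m=|E|\ge 2$ edges and let $\mathcal I,\mathcal J$ be arbitrary (finite or infinite) index sets. For $w:\mathcal I\times\mathcal J\to\mathbb R$ put $$h_H(w)=\sum_{(x_a)\in\mathcal I^X}\ \sum_{(y_b)\in\mathcal J^Y}\ \prod_{(u,v)\in E}w(x_u,y_v),\qquad \|w\|_H=|h_H(w)|^{1/m},$$ and let $\mathcal W_H=\mathcal W_H(\mathcal I\times\mathcal J)$ be the set of all $w$ for which $\|w\|_H$ is finite, i.e. for which the (unordered) sum $h_H(w)$ over $\mathcal I^X\times\mathcal J^Y$ converges. Suppose that $\|\cdot\|_H$ is a norm on $\mathcal W_H$ (in particular, that $\mathcal W_H$ is a vector space). Then: 1. $\mathcal W_H$ is of type $2$: there is a constant $M$ such that for all $n$ and all $w_1,\dots,w_n\in\mathcal W_H$ $$2^{-n}\sum_{\varepsilon\in\{\pm1\}^n}\Big\|\sum_{i=1}^n\varepsilon_iw_i\Big\|_H\le M\Big(\sum_{i=1}^n\|w_i\|_H^2\Big)^{1/2}.$$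 2. $\mathcal W_H$ is of cotype $m$, where a normed space is of cotype $q$ if there is a constant $M$ such that for all $n$ and all vectors $w_1,\dots,w_n$ $$\Big(\sum_{i=1}^n\|w_i\|^q\Big)^{1/q}\le M\,2^{-n}\sum_{\varepsilon\in\{\pm1\}^n}\Big\|\sum_{i=1}^n\varepsilon_iw_i\Big\|.$$ 3. If, moreover, $H$ is connected and $\mathcal I$ and $\mathcal J$ are both infinite, then $\mathcal W_H$ is not of cotype $q$ for any real $0<q<m$. -/

import Mathlib

open scoped BigOperators

/-- A bipartite multigraph `(X, Y; E)` with a fixed bipartization: every edge `e : E` joins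
`H.src e` in `X` to `H.tgt e` in `Y`. Different edges may have the same end points, so `E`
together with `src`, `tgt` is a multiset of elements of `X × Y`. -/
structure BipartiteGraph (X Y E : Type*) where
  src : E → X
  tgt : E → Y

namespace BipartiteGraph

variable {X Y E : Type*} [Fintype E]

/-- The underlying simple graph on the vertex set `X ⊔ Y`. -/
def toSimpleGraph (H : BipartiteGraph X Y E) : SimpleGraph (X ⊕ Y) :=
  SimpleGraph.fromRel fun a b => ∃ e, a = Sum.inl (H.src e) ∧ b = Sum.inr (H.tgt e)

/-- `H` is connected as a graph on `X ⊔ Y`. -/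
def IsConnected (H : BipartiteGraph X Y E) : Prop :=
  H.toSimpleGraph.Connected

/-- The term of the sum `h_H(w)` that belongs to an assignment `p = ((x_a)_{a ∈ X}, (y_b)_{b ∈ Y})`:
the product of `w (x_u) (y_v)` over all edges `(u, v)`. -/
def homTerm {I J : Type*} (H : BipartiteGraph X Y E) (w : I → J → ℝ)
    (p : (X → I) × (Y → J)) : ℝ :=
  ∏ e : E, w (p.1 (H.src e)) (p.2 (H.tgt e))

/-- `h_H(w)`: the sum of the terms over all assignments. -/
noncomputable def hom {I J : Type*} (H : BipartiteGraph X Y E) (w : I → J → ℝ) : ℝ :=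
  ∑' p : (X → I) × (Y → J), H.homTerm w p

/-- `‖w‖_H = |h_H(w)| ^ (1 / |E|)`. -/
noncomputable def graphNorm {I J : Type*} (H : BipartiteGraph X Y E) (w : I → J → ℝ) : ℝ :=
  |H.hom w| ^ (1 / (Fintype.card E : ℝ))

/-- `W_H(I × J)`: the real matrices `w` for which `‖w‖_H` is finite, that is, for which
the sum that defines `h_H(w)` converges (as a sum over an unordered index set). -/
def space (H : BipartiteGraph X Y E) (I J : Type*) : Set (I → J → ℝ) :=
  {w | Summable (H.homTerm w)}

end BipartiteGraph

section NormedSpaces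

variable {V : Type*} [AddCommGroup V] [Module ℝ V]

/-- `(S, N)` is a normed space: `S` is a linear subspace of `V` and `N` is a norm on `S`. -/
structure IsNormOn (S : Set V) (N : V → ℝ) : Prop where
  zero_mem : (0 : V) ∈ S
  add_mem : ∀ x ∈ S, ∀ y ∈ S, x + y ∈ S
  smul_mem : ∀ (c : ℝ), ∀ x ∈ S, c • x ∈ S
  nonneg : ∀ x ∈ S, 0 ≤ N x
  eq_zero_iff : ∀ x ∈ S, N x = 0 ↔ x = 0
  smul : ∀ (c : ℝ), ∀ x ∈ S, N (c • x) = |c| * N x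
  add_le : ∀ x ∈ S, ∀ y ∈ S, N (x + y) ≤ N x + N y

/-- The average of `N (± x₁ ± ⋯ ± xₙ)` over all `2 ^ n` choices of signs, that is,
`∫₀¹ N (∑ i, rᵢ(t) xᵢ) dt` for the Rademacher functions `rᵢ`. -/
noncomputable def rademacherAverage (N : V → ℝ) {n : ℕ} (x : Fin n → V) : ℝ :=
  (∑ ε : Fin n → Bool, N (∑ i, (if ε i then (1 : ℝ) else -1) • x i)) / 2 ^ n

/-- The normed space `(S, N)` is of type `p`. -/
def HasTypeOn (S : Set V) (N : V → ℝ) (p : ℝ) : Prop :=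
  ∃ M : ℝ, ∀ (n : ℕ) (x : Fin n → V), (∀ i, x i ∈ S) →
    rademacherAverage N x ≤ M * (∑ i, N (x i) ^ p) ^ (1 / p)

/-- The normed space `(S, N)` is of cotype `q`. -/
def HasCotypeOn (S : Set V) (N : V → ℝ) (q : ℝ) : Prop :=
  ∃ M : ℝ, ∀ (n : ℕ) (x : Fin n → V), (∀ i, x i ∈ S) →
    (∑ i, N (x i) ^ q) ^ (1 / q) ≤ M * rademacherAverage N x

end NormedSpaces

/-!
If the number `m` of edges is even, then `h_H ≥ 0` on `W_H`, so that `‖·‖_H ^ m = h_H` is, along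
every line `t ↦ x + t y`, a polynomial in `t` of degree at most `m` whose coefficient at `t ^ m` is
`‖y‖_H ^ m`. Both the type and the cotype follow from this property alone, for an arbitrary
seminorm `p` (`Seminorm.IsPolynomialPow`). The coefficients of a real polynomial of degree at most
`m` are bounded by a constant depending on `m` times its maximum on `[0, 1]` (`exists_coeff_bound`).

* Applied to the even part of `t ↦ p (x + t y) ^ m`, which by convexity of `p` stays between
  `p x ^ m` and its value at `t = 1`, the bound on the top coefficient gives the uniform convexity
  estimate `p x ^ m + δ p y ^ m ≤ (p (x + y) ^ m + p (x - y) ^ m) / 2`. By induction on the number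
  of vectors, `δ ∑ p (x i) ^ m` is at most the average of `p (∑ ± x i) ^ m`. The Kahane–Khintchine
  inequality (`Seminorm.exists_signAverage_pow_le`) replaces the `m`-th moment by the first one,
  which is cotype `m`.
* The even part has no linear term, so the bounds on the other coefficients give the uniform
  smoothness estimate `(p (x + y) ^ 2 + p (x - y) ^ 2) / 2 ≤ p x ^ 2 + K p y ^ 2`, hence type `2`
  by induction.

The Kahane–Khintchine inequality is proved by hypercontractivity: for small `σ`, the `2 k`-th moment
of `p (x₀ + σ ∑ ± x i)` is at most the `k`-th power of the second moment of `p (x₀ + ∑ ± x i)`.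

The sign of `h_H` is controlled by the intermediate value theorem on segments of `W_H`: since
`‖·‖_H` is a norm, `h_H` vanishes only at `0`, so a segment on which `h_H` changes sign passes
through `0`. For even `m` the segment from `w` to `|w|` shows that `h_H(w) ≥ 0`. For odd `m`,
where `h_H(-w) = -h_H(w)`, segments from `x` to `± y` show that `W_H` is at most one-dimensional;
then `‖·‖_H ^ 2` is a polynomial along lines, and cotype `2` implies cotype `m`.

For connected `H`, a diagonal matrix with entries `c k` in distinct rows and distinct columns
satisfies `h_H = ∑ c k ^ m`. Hence `n` matrix units on the diagonal have norm `1`, while all their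
signed sums have norm at most `n ^ (1 / m)`, and cotype `q` would give
`n ^ (1 / q) ≤ M n ^ (1 / m)` for all `n`.
-/

/-! ### Elementary inequalities -/

/-- The coefficients of a polynomial of degree at most `m` are controlled by its values on `[0, 1]`:
they are recovered from the values at `m + 1` equidistant points by the inverse Vandermonde matrix. -/
theorem exists_coeff_bound (m : ℕ) : ∃ C : ℝ, 0 < C ∧ ∀ (c : ℕ → ℝ) (B : ℝ),
    (∀ t ∈ Set.Icc (0 : ℝ) 1, |∑ k ∈ Finset.range (m + 1), c k * t ^ k| ≤ B) →
    ∀ k ≤ m, |c k| ≤ C * B := by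
  set A : Matrix (Fin (m + 1)) (Fin (m + 1)) ℝ :=
    Matrix.vandermonde fun i => (i : ℝ) / (m + 1) with hA
  have hm : (0 : ℝ) < m + 1 := by positivity
  have hdet : IsUnit A.det := by
    rw [isUnit_iff_ne_zero, hA, Matrix.det_vandermonde_ne_zero_iff]
    intro i j hij
    have : (i : ℝ) = j := by
      have h := hij
      simp only at h
      field_simp at h
      exact h
    exact Fin.ext (by exact_mod_cast this)
  refine ⟨1 + ∑ i, ∑ j, |A⁻¹ i j|, by positivity, fun c B hB k hk => ?_⟩
  have hB0 : 0 ≤ B := (abs_nonneg _).trans (hB 0 (by simp))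
  set v : Fin (m + 1) → ℝ := A.mulVec fun k : Fin (m + 1) => c k with hv
  have hvB : ∀ i, |v i| ≤ B := by
    intro i
    have hi : (i : ℝ) / (m + 1) ∈ Set.Icc (0 : ℝ) 1 := by
      refine ⟨by positivity, (div_le_one hm).2 ?_⟩
      exact_mod_cast i.2.le
    have := hB _ hi
    rw [Finset.sum_range] at this
    convert this using 2
    simp [hv, hA, Matrix.mulVec, dotProduct, Matrix.vandermonde_apply, mul_comm]
  have hck : c k = ∑ j, A⁻¹ ⟨k, by omega⟩ j * v j := by
    have h1 : A⁻¹.mulVec v = fun k : Fin (m + 1) => c k := by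
      rw [hv, Matrix.mulVec_mulVec, Matrix.nonsing_inv_mul _ hdet, Matrix.one_mulVec]
    exact (congrFun h1 ⟨k, by omega⟩).symm
  calc |c k| ≤ ∑ j, |A⁻¹ ⟨k, by omega⟩ j * v j| := by
        rw [hck]; exact Finset.abs_sum_le_sum_abs _ _
    _ ≤ ∑ j, |A⁻¹ ⟨k, by omega⟩ j| * B := by
        refine Finset.sum_le_sum fun j _ => ?_
        rw [abs_mul]
        exact mul_le_mul_of_nonneg_left (hvB j) (abs_nonneg _)
    _ = (∑ j, |A⁻¹ ⟨k, by omega⟩ j|) * B := by rw [Finset.sum_mul]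
    _ ≤ (1 + ∑ i, ∑ j, |A⁻¹ i j|) * B := by
        refine mul_le_mul_of_nonneg_right ?_ hB0
        have : ∑ j, |A⁻¹ ⟨k, by omega⟩ j| ≤ ∑ i, ∑ j, |A⁻¹ i j| :=
          Finset.single_le_sum (f := fun i => ∑ j, |A⁻¹ i j|)
            (fun i _ => by positivity) (Finset.mem_univ (⟨k, by omega⟩ : Fin (m + 1)))
        linarith

/-- The two-point inequality behind hypercontractivity. It is proved together with a bound for
`((s + t) ^ k - (s - t) ^ k) / 2`, as the two expressions satisfy a joint recursion in `k`. -/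
theorem half_add_pow_sub_pow_le {s t r : ℝ} (hs : 0 ≤ s) (hr : 0 ≤ r) (k : ℕ)
    (h : k * t ^ 2 ≤ s * r) : ((s + t) ^ k + (s - t) ^ k) / 2 ≤ (s + r) ^ k := by
  rcases hs.eq_or_lt with rfl | hs
  · rcases Nat.eq_zero_or_pos k with rfl | hk
    · simp
    · have hk' : (0 : ℝ) < k := by exact_mod_cast hk
      have : t ^ 2 ≤ 0 := by
        by_contra! h'
        have := mul_pos hk' h'
        linarith
      have ht : t = 0 := by nlinarith
      subst ht
      simp [zero_pow hk.ne']
      positivity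
  suffices H : ∀ j ≤ k, ((s + t) ^ j + (s - t) ^ j) / 2 ≤ (s + r) ^ j ∧
      s * (t * (((s + t) ^ j - (s - t) ^ j) / 2)) ≤ j * t ^ 2 * (s + r) ^ j from (H k le_rfl).1
  intro j
  induction j with
  | zero => simp
  | succ j ih =>
    intro hj
    obtain ⟨h1, h2⟩ := ih (by omega)
    have hP : 0 ≤ (s + r) ^ j := by positivity
    have hjk : (j : ℝ) * t ^ 2 ≤ s * r := by
      refine le_trans (mul_le_mul_of_nonneg_right ?_ (sq_nonneg t)) h
      exact_mod_cast (by omega : j ≤ k)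
    constructor
    · have h3 : t * (((s + t) ^ j - (s - t) ^ j) / 2) ≤ r * (s + r) ^ j := by
        refine le_of_mul_le_mul_left (h2.trans ?_) hs
        rw [← mul_assoc]
        exact mul_le_mul_of_nonneg_right hjk hP
      have h4 := mul_le_mul_of_nonneg_left h1 hs.le
      calc ((s + t) ^ (j + 1) + (s - t) ^ (j + 1)) / 2
          = s * (((s + t) ^ j + (s - t) ^ j) / 2) + t * (((s + t) ^ j - (s - t) ^ j) / 2) := by
            ring
        _ ≤ s * (s + r) ^ j + r * (s + r) ^ j := add_le_add h4 h3
        _ = (s + r) ^ (j + 1) := by ring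
    · have h4 := mul_le_mul_of_nonneg_left h1 (by positivity : 0 ≤ s * t ^ 2)
      have h5 := mul_le_mul_of_nonneg_left h2 hs.le
      push_cast
      calc s * (t * (((s + t) ^ (j + 1) - (s - t) ^ (j + 1)) / 2))
          = s * (s * (t * (((s + t) ^ j - (s - t) ^ j) / 2))) +
            s * t ^ 2 * (((s + t) ^ j + (s - t) ^ j) / 2) := by ring
        _ ≤ s * (j * t ^ 2 * (s + r) ^ j) + s * t ^ 2 * (s + r) ^ j := add_le_add h5 h4
        _ = (j + 1) * t ^ 2 * (s * (s + r) ^ j) := by ring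
        _ ≤ (j + 1) * t ^ 2 * ((s + r) * (s + r) ^ j) := by
            gcongr; linarith
        _ = (j + 1) * t ^ 2 * (s + r) ^ (j + 1) := by ring

theorem half_add_pow_le {a b : ℝ} (ha : 0 ≤ a) (hb : 0 ≤ b) (k : ℕ) :
    ((a + b) / 2) ^ k ≤ (a ^ k + b ^ k) / 2 := by
  have := (convexOn_pow (𝕜 := ℝ) k).2 (Set.mem_Ici.2 ha) (Set.mem_Ici.2 hb)
    (by norm_num : (0 : ℝ) ≤ 1 / 2) (by norm_num : (0 : ℝ) ≤ 1 / 2) (by norm_num)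
  simp only [smul_eq_mul] at this
  calc _ = (1 / 2 * a + 1 / 2 * b) ^ k := by ring
    _ ≤ _ := this
    _ = _ := by ring

/-! ### Averages over signs -/

section SignAverage

variable {V : Type*} [AddCommGroup V] [Module ℝ V]

/-- The average of `F (x₀ ± x₁ ± ⋯ ± xₙ)` over all choices of signs. The base point `x₀` is a
parameter so that inductions on the number of vectors can absorb `± x₁` into it. -/
noncomputable def signAverage (F : V → ℝ) {n : ℕ} (x₀ : V) (x : Fin n → V) : ℝ :=
  (∑ ε : Fin n → Bool, F (x₀ + ∑ i, (if ε i then (1 : ℝ) else -1) • x i)) / 2 ^ n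

theorem signAverage_zero_right (F : V → ℝ) (x₀ : V) (x : Fin 0 → V) :
    signAverage F x₀ x = F x₀ := by
  simp [signAverage]

theorem signAverage_succ (F : V → ℝ) {n : ℕ} (x₀ : V) (x : Fin (n + 1) → V) :
    signAverage F x₀ x =
      (signAverage F (x₀ + x 0) (Fin.tail x) + signAverage F (x₀ - x 0) (Fin.tail x)) / 2 := by
  unfold signAverage
  rw [← (Fin.consEquiv fun _ : Fin (n + 1) => Bool).sum_comp, Fintype.sum_prod_type]
  simp only [Fintype.sum_bool, Fin.consEquiv_apply, Fin.sum_univ_succ, Fin.cons_zero,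
    Fin.cons_succ, Fin.tail, if_true, one_smul, neg_smul, ← add_assoc, ← sub_eq_add_neg,
    Bool.false_eq_true, if_false]
  rw [pow_succ, ← add_div, div_div]

theorem signAverage_mono {F G : V → ℝ} (h : ∀ v, F v ≤ G v) {n : ℕ} (x₀ : V) (x : Fin n → V) :
    signAverage F x₀ x ≤ signAverage G x₀ x := by
  unfold signAverage
  gcongr
  exact h _

theorem signAverage_nonneg {F : V → ℝ} (h : ∀ v, 0 ≤ F v) {n : ℕ} (x₀ : V) (x : Fin n → V) :
    0 ≤ signAverage F x₀ x :=
  div_nonneg (Finset.sum_nonneg fun _ _ => h _) (by positivity)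

theorem signAverage_add (F G : V → ℝ) {n : ℕ} (x₀ : V) (x : Fin n → V) :
    signAverage (fun v => F v + G v) x₀ x = signAverage F x₀ x + signAverage G x₀ x := by
  simp only [signAverage, Finset.sum_add_distrib, add_div]

theorem signAverage_const_mul (a : ℝ) (F : V → ℝ) {n : ℕ} (x₀ : V) (x : Fin n → V) :
    signAverage (fun v => a * F v) x₀ x = a * signAverage F x₀ x := by
  simp only [signAverage, ← Finset.mul_sum, mul_div_assoc]

theorem signAverage_shift (F : V → ℝ) {n : ℕ} (x₀ z : V) (x : Fin n → V) :
    signAverage F (x₀ + z) x = signAverage (fun v => F (v + z)) x₀ x := by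
  simp only [signAverage, add_right_comm]

/-- Cauchy–Schwarz for averages over signs. -/
theorem signAverage_mul_sq_le (F G : V → ℝ) {n : ℕ} (x₀ : V) (x : Fin n → V) :
    signAverage (fun v => F v * G v) x₀ x ^ 2 ≤
      signAverage (fun v => F v ^ 2) x₀ x * signAverage (fun v => G v ^ 2) x₀ x := by
  simp only [signAverage]
  rw [div_pow, div_mul_div_comm, ← sq]
  gcongr
  exact Finset.sum_mul_sq_le_sq_mul_sq _ _ _

/-- The power-mean (Jensen) inequality for averages over signs. -/
theorem signAverage_pow_le {F : V → ℝ} (h : ∀ v, 0 ≤ F v) (k : ℕ) {n : ℕ} (x₀ : V)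
    (x : Fin n → V) :
    signAverage F x₀ x ^ k ≤ signAverage (fun v => F v ^ k) x₀ x := by
  induction n generalizing x₀ with
  | zero => simp [signAverage_zero_right]
  | succ n ih =>
    rw [signAverage_succ, signAverage_succ]
    refine le_trans ?_ (div_le_div_of_nonneg_right (add_le_add (ih _ _) (ih _ _)) two_pos.le)
    exact half_add_pow_le (signAverage_nonneg h _ _) (signAverage_nonneg h _ _) k

end SignAverage

/-! ### The Kahane–Khintchine inequality -/

section Kahane

variable {V : Type*} [AddCommGroup V] [Module ℝ V]

theorem Seminorm.map_add_smul_le (p : Seminorm ℝ V) (u y : V) {σ : ℝ} (h : |σ| ≤ 1) :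
    p (u + σ • y) ≤ (1 + σ) / 2 * p (u + y) + (1 - σ) / 2 * p (u - y) := by
  obtain ⟨h1, h2⟩ := abs_le.1 h
  have : u + σ • y = ((1 + σ) / 2) • (u + y) + ((1 - σ) / 2) • (u - y) := by module
  rw [this]
  refine (map_add_le_add p _ _).trans_eq ?_
  rw [map_smul_eq_mul, map_smul_eq_mul, Real.norm_of_nonneg (by linarith),
    Real.norm_of_nonneg (by linarith)]

/-- Hypercontractivity: damping the random part by a small factor `σ` bounds the `2 k`-th moment
of a seminorm by its second moment. -/
theorem Seminorm.signAverage_pow_smul_le (p : Seminorm ℝ V) (k : ℕ) {σ : ℝ} (hσ0 : 0 ≤ σ)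
    (hσ : σ ^ 2 * (1 + 4 * k) ≤ 1) {n : ℕ} (x₀ : V) (x : Fin n → V) :
    signAverage (fun v => p v ^ (2 * k)) x₀ (fun i => σ • x i) ≤
      signAverage (fun v => p v ^ 2) x₀ x ^ k := by
  have hσ1 : σ ≤ 1 := by
    by_contra! h
    have : (0 : ℝ) ≤ k := by positivity
    nlinarith
  induction n generalizing x₀ with
  | zero => simp [signAverage_zero_right, pow_mul]
  | succ n ih =>
    -- `a u ± τ b u` are the values at `± τ` of the affine interpolation between `p (u ± x 0)`;
    -- by convexity they dominate `p (u ± τ x 0)`, which reduces the step to scalars.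
    set a : V → ℝ := fun u => (p (u + x 0) + p (u - x 0)) / 2 with ha
    set b : V → ℝ := fun u => (p (u + x 0) - p (u - x 0)) / 2 with hb
    set y := Fin.tail x with hy
    set A := signAverage (fun v => a v ^ 2) x₀ y with hA
    set B := signAverage (fun v => b v ^ 2) x₀ y with hB
    set C := signAverage (fun v => a v * b v) x₀ y with hC
    have hA0 : 0 ≤ A := signAverage_nonneg (fun _ => sq_nonneg _) _ _
    have hB0 : 0 ≤ B := signAverage_nonneg (fun _ => sq_nonneg _) _ _
    have hCAB : C ^ 2 ≤ A * B := signAverage_mul_sq_le _ _ _ _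
    have hquad : ∀ τ : ℝ, signAverage (fun v => (a v + τ * b v) ^ 2) x₀ y =
        A + τ ^ 2 * B + 2 * τ * C := by
      intro τ
      rw [hA, hB, hC, ← signAverage_const_mul, ← signAverage_const_mul, ← signAverage_add,
        ← signAverage_add]
      congr 1
      ext v
      ring
    have hshift : ∀ τ : ℝ, |τ| ≤ 1 → signAverage (fun v => p v ^ 2) (x₀ + τ • x 0) y ≤
        A + τ ^ 2 * B + 2 * τ * C := by
      intro τ hτ
      rw [signAverage_shift, ← hquad]
      refine signAverage_mono (fun v => ?_) _ _
      refine pow_le_pow_left₀ (apply_nonneg p _) ((p.map_add_smul_le v (x 0) hτ).trans_eq ?_) 2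
      simp only [ha, hb]
      ring
    have hAB : signAverage (fun v => p v ^ 2) x₀ x = A + B := by
      rw [signAverage_succ, sub_eq_add_neg, signAverage_shift, signAverage_shift,
        ← signAverage_add, hA, hB, ← signAverage_add, div_eq_inv_mul, ← signAverage_const_mul]
      congr 1
      ext v
      simp only [ha, hb, sub_eq_add_neg]
      ring
    have htail : Fin.tail (fun i => σ • x i) = fun i => σ • y i := rfl
    rw [signAverage_succ, htail, hAB]
    have h1 := (ih (x₀ + σ • x 0) y).trans (pow_le_pow_left₀
      (signAverage_nonneg (fun _ => sq_nonneg _) _ _) (hshift σ (abs_le.2 ⟨by linarith, hσ1⟩)) k)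
    have h2 := (ih (x₀ + (-σ) • x 0) y).trans (pow_le_pow_left₀
      (signAverage_nonneg (fun _ => sq_nonneg _) _ _)
      (hshift (-σ) (abs_le.2 ⟨by linarith, by linarith⟩)) k)
    rw [neg_smul, ← sub_eq_add_neg] at h2
    have hs : 0 ≤ A + σ ^ 2 * B := by positivity
    have h3 := half_add_pow_sub_pow_le (s := A + σ ^ 2 * B) (t := 2 * σ * C)
      (r := 4 * k * σ ^ 2 * B) hs (by positivity) k (by
        have h4 : 0 ≤ 4 * k * σ ^ 2 := by positivity
        nlinarith [mul_le_mul_of_nonneg_left hCAB h4, mul_nonneg h4 (mul_nonneg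
          (mul_nonneg (sq_nonneg σ) hB0) hB0)])
    calc _ ≤ ((A + σ ^ 2 * B + 2 * σ * C) ^ k + (A + σ ^ 2 * B - 2 * σ * C) ^ k) / 2 := by
          refine div_le_div_of_nonneg_right (add_le_add h1 (h2.trans_eq ?_)) two_pos.le
          ring
      _ ≤ _ := h3
      _ ≤ (A + B) ^ k := by
          refine pow_le_pow_left₀ (by positivity) ?_ k
          nlinarith [mul_le_mul_of_nonneg_right hσ hB0]

theorem Seminorm.exists_signAverage_pow_two_mul_le (k : ℕ) : ∃ K : ℝ, 0 < K ∧
    ∀ (p : Seminorm ℝ V) (n : ℕ) (x : Fin n → V),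
      signAverage (fun v => p v ^ (2 * k)) 0 x ≤ K * signAverage (fun v => p v ^ 2) 0 x ^ k := by
  set σ : ℝ := (1 + 4 * k : ℝ)⁻¹ with hσ
  have hk : (0 : ℝ) < 1 + 4 * k := by positivity
  have hσ0 : 0 < σ := by positivity
  have hσ2 : σ ^ 2 * (1 + 4 * k) ≤ 1 := by
    have h1 : σ * (1 + 4 * k) = 1 := inv_mul_cancel₀ hk.ne'
    have h2 : σ ≤ 1 := inv_le_one_of_one_le₀ (by linarith [(Nat.cast_nonneg k : (0 : ℝ) ≤ k)])
    calc σ ^ 2 * (1 + 4 * k) = σ * (σ * (1 + 4 * k)) := by ring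
      _ ≤ 1 := by rw [h1, mul_one]; exact h2
  refine ⟨(σ⁻¹) ^ (2 * k), by positivity, fun p n x => ?_⟩
  have h := p.signAverage_pow_smul_le k hσ0.le hσ2 0 x
  have : signAverage (fun v => p v ^ (2 * k)) 0 (fun i => σ • x i) =
      σ ^ (2 * k) * signAverage (fun v => p v ^ (2 * k)) 0 x := by
    simp only [signAverage, zero_add]
    rw [← mul_div_assoc, Finset.mul_sum]
    congr 1
    refine Finset.sum_congr rfl fun ε _ => ?_
    simp only [smul_comm _ σ, ← Finset.smul_sum, map_smul_eq_mul, mul_pow,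
      Real.norm_of_nonneg hσ0.le]
  rw [this] at h
  calc _ = (σ⁻¹) ^ (2 * k) * (σ ^ (2 * k) * signAverage (fun v => p v ^ (2 * k)) 0 x) := by
        rw [← mul_assoc, ← mul_pow, inv_mul_cancel₀ hσ0.ne', one_pow, one_mul]
    _ ≤ _ := mul_le_mul_of_nonneg_left h (by positivity)

/-- The first and second moments are comparable: with `E k` the `k`-th moment, Cauchy–Schwarz gives
`E 2 ^ 2 ≤ E 1 * E 3` and `E 3 ^ 2 ≤ E 2 * E 4`, and `E 4 ≤ K * E 2 ^ 2` by hypercontractivity. -/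
theorem Seminorm.exists_signAverage_sq_le : ∃ K : ℝ, 0 < K ∧
    ∀ (p : Seminorm ℝ V) (n : ℕ) (x : Fin n → V),
      signAverage (fun v => p v ^ 2) 0 x ≤ K * signAverage p 0 x ^ 2 := by
  obtain ⟨K, hK, h⟩ := Seminorm.exists_signAverage_pow_two_mul_le (V := V) 2
  refine ⟨K, hK, fun p n x => ?_⟩
  have h0 : ∀ k, 0 ≤ signAverage (fun v => p v ^ k) 0 x := fun k =>
    signAverage_nonneg (fun _ => by positivity) _ _
  set E1 := signAverage p 0 x with hE1
  set E2 := signAverage (fun v => p v ^ 2) 0 x with hE2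
  set E3 := signAverage (fun v => p v ^ 3) 0 x with hE3
  set E4 := signAverage (fun v => p v ^ 4) 0 x with hE4
  have h4 : E4 ≤ K * E2 ^ 2 := h p n x
  have h23 : E2 ^ 2 ≤ E1 * E3 := by
    have := signAverage_mul_sq_le (fun v => √(p v)) (fun v => √(p v) * p v) 0 x
    refine le_trans (le_of_eq ?_) (this.trans_eq ?_)
    · refine congrArg (fun F => signAverage F 0 x ^ 2) (funext fun v => ?_)
      rw [← mul_assoc, Real.mul_self_sqrt (apply_nonneg p v), sq]
    · congr 2
      · ext v
        rw [Real.sq_sqrt (apply_nonneg p v)]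
      · ext v
        rw [mul_pow, Real.sq_sqrt (apply_nonneg p v)]
        ring
  have h34 : E3 ^ 2 ≤ E2 * E4 := by
    have := signAverage_mul_sq_le p (fun v => p v ^ 2) 0 x
    refine le_trans (le_of_eq ?_) (this.trans_eq ?_)
    · refine congrArg (fun F => signAverage F 0 x ^ 2) (funext fun v => ?_)
      ring
    · refine congrArg (fun F => E2 * signAverage F 0 x) (funext fun v => ?_)
      ring
  have h2 : 0 ≤ E2 := h0 2
  have h1 : 0 ≤ E1 := signAverage_nonneg (fun _ => apply_nonneg p _) _ _
  rcases h2.eq_or_lt with h2' | h2'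
  · rw [← h2']; positivity
  have h3 : 0 ≤ E3 := h0 3
  have key : E2 ^ 3 * E2 ≤ E2 ^ 3 * (K * E1 ^ 2) := by
    calc E2 ^ 3 * E2 = (E2 ^ 2) ^ 2 := by ring
      _ ≤ (E1 * E3) ^ 2 := by gcongr
      _ = E1 ^ 2 * E3 ^ 2 := by ring
      _ ≤ E1 ^ 2 * (E2 * (K * E2 ^ 2)) := by
          gcongr
          exact h34.trans (mul_le_mul_of_nonneg_left h4 h2)
      _ = _ := by ring
  exact le_of_mul_le_mul_left key (by positivity)

/-- The Kahane–Khintchine inequality for even moments. -/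
theorem Seminorm.exists_signAverage_pow_le (k : ℕ) : ∃ K : ℝ, 0 < K ∧
    ∀ (p : Seminorm ℝ V) (n : ℕ) (x : Fin n → V),
      signAverage (fun v => p v ^ (2 * k)) 0 x ≤ K * signAverage p 0 x ^ (2 * k) := by
  obtain ⟨K, hK, h⟩ := Seminorm.exists_signAverage_pow_two_mul_le (V := V) k
  obtain ⟨L, hL, h'⟩ := Seminorm.exists_signAverage_sq_le (V := V)
  refine ⟨K * L ^ k, by positivity, fun p n x => (h p n x).trans ?_⟩
  rw [mul_assoc, pow_mul, ← mul_pow]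
  refine mul_le_mul_of_nonneg_left (pow_le_pow_left₀ ?_ (h' p n x) k) hK.le
  exact signAverage_nonneg (fun _ => sq_nonneg _) _ _

end Kahane

/-! ### Seminorms with a polynomial power -/

section PolynomialPower

variable {V : Type*} [AddCommGroup V] [Module ℝ V]

/-- Along every line `t ↦ x + t • y` the function `p ^ m` is a polynomial in `t` of degree at most
`m`, and the coefficient of `t ^ m` is `p y ^ m`. -/
def Seminorm.IsPolynomialPow (p : Seminorm ℝ V) (m : ℕ) : Prop :=
  ∀ x y : V, ∃ c : ℕ → ℝ, c m = p y ^ m ∧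
    ∀ t : ℝ, p (x + t • y) ^ m = ∑ k ∈ Finset.range (m + 1), c k * t ^ k

/-- The even part of a polynomial keeps the coefficients of even index. -/
theorem Finset.sum_range_mul_pow_add_neg (c : ℕ → ℝ) (n : ℕ) (t : ℝ) :
    ((∑ k ∈ Finset.range n, c k * t ^ k) + ∑ k ∈ Finset.range n, c k * (-t) ^ k) / 2 =
      ∑ k ∈ Finset.range n, (if Even k then c k else 0) * t ^ k := by
  rw [← Finset.sum_add_distrib, Finset.sum_div]
  refine Finset.sum_congr rfl fun k _ => ?_
  split_ifs with h
  · rw [h.neg_pow]; ring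
  · rw [(Nat.not_even_iff_odd.1 h).neg_pow]; ring

theorem Seminorm.le_half_add (p : Seminorm ℝ V) (x y : V) :
    p x ≤ (p (x + y) + p (x - y)) / 2 := by
  have := p.map_add_smul_le x y (σ := 0) (by simp)
  simp only [zero_smul, add_zero, sub_zero] at this
  linarith

theorem Seminorm.pow_add_smul_add_pow_le (p : Seminorm ℝ V) (m : ℕ) (x y : V) {t : ℝ}
    (ht : |t| ≤ 1) :
    p (x + t • y) ^ m + p (x + (-t) • y) ^ m ≤ p (x + y) ^ m + p (x - y) ^ m := by
  have key : ∀ s : ℝ, |s| ≤ 1 → p (x + s • y) ^ m ≤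
      (1 + s) / 2 * p (x + y) ^ m + (1 - s) / 2 * p (x - y) ^ m := by
    intro s hs
    obtain ⟨h1, h2⟩ := abs_le.1 hs
    refine (pow_le_pow_left₀ (apply_nonneg p _) (p.map_add_smul_le x y hs) m).trans ?_
    exact (convexOn_pow (𝕜 := ℝ) m).2 (Set.mem_Ici.2 (apply_nonneg p (x + y)))
      (Set.mem_Ici.2 (apply_nonneg p (x - y))) (by linarith : (0 : ℝ) ≤ (1 + s) / 2)
      (by linarith : (0 : ℝ) ≤ (1 - s) / 2) (by ring)
  have h1 := key t ht
  have h2 := key (-t) (by rwa [abs_neg])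
  linarith

/-- Uniform convexity of power type `m`. -/
theorem Seminorm.IsPolynomialPow.exists_uniformlyConvex {m : ℕ} (hm0 : 0 < m) (hm : Even m) :
    ∃ δ : ℝ, 0 < δ ∧ ∀ (p : Seminorm ℝ V), p.IsPolynomialPow m → ∀ x y : V,
      p x ^ m + δ * p y ^ m ≤ (p (x + y) ^ m + p (x - y) ^ m) / 2 := by
  obtain ⟨C, hC, hbound⟩ := exists_coeff_bound m
  refine ⟨C⁻¹, by positivity, fun p hp x y => ?_⟩
  obtain ⟨c, hcm, hc⟩ := hp x y
  -- `d` are the coefficients of the even part of `t ↦ p (x + t • y) ^ m - p x ^ m`.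
  set d : ℕ → ℝ := fun k => if k = 0 then 0 else if Even k then c k else 0 with hd
  have hc0 : c 0 = p x ^ m := by
    have := hc 0
    simp only [zero_smul, add_zero] at this
    rw [this, Finset.sum_range_succ', Finset.sum_eq_zero] <;> simp
  have heval : ∀ t : ℝ, ∑ k ∈ Finset.range (m + 1), d k * t ^ k =
      (p (x + t • y) ^ m + p (x + (-t) • y) ^ m) / 2 - p x ^ m := by
    intro t
    rw [hc, hc, Finset.sum_range_mul_pow_add_neg, Finset.sum_range_succ',
      Finset.sum_range_succ' _ m]
    simp [hd, hc0]
  have hle := hbound d ((p (x + y) ^ m + p (x - y) ^ m) / 2 - p x ^ m) (fun t ht => by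
    have ht1 : |t| ≤ 1 := abs_le.2 ⟨by linarith [ht.1], ht.2⟩
    rw [heval, abs_of_nonneg]
    · linarith [p.pow_add_smul_add_pow_le m x y ht1]
    · have h1 := pow_le_pow_left₀ (apply_nonneg p _) (p.le_half_add x (t • y)) m
      have h2 := half_add_pow_le (apply_nonneg p (x + t • y)) (apply_nonneg p (x - t • y)) m
      rw [neg_smul, ← sub_eq_add_neg]
      linarith) m le_rfl
  have hdm : d m = p y ^ m := by simp [hd, hm0.ne', hm, hcm]
  rw [hdm, abs_of_nonneg (pow_nonneg (apply_nonneg p _) _)] at hle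
  have := mul_le_mul_of_nonneg_left hle (inv_nonneg.2 hC.le)
  rw [← mul_assoc, inv_mul_cancel₀ hC.ne', one_mul] at this
  linarith

/-- Uniform smoothness of power type `2`. -/
theorem Seminorm.IsPolynomialPow.exists_uniformlySmooth {m : ℕ} (hm0 : 0 < m) (hm : Even m) :
    ∃ K : ℝ, 0 < K ∧ ∀ (p : Seminorm ℝ V), p.IsPolynomialPow m → ∀ x y : V,
      (p (x + y) ^ 2 + p (x - y) ^ 2) / 2 ≤ p x ^ 2 + K * p y ^ 2 := by
  obtain ⟨C, hC, hbound⟩ := exists_coeff_bound m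
  set K : ℝ := m * (C * 2 ^ m) with hK
  have hK0 : 0 < K := by positivity
  refine ⟨K + 4, by positivity, fun p hp x y => ?_⟩
  set r := p x with hr
  set s := p y with hs
  have hr0 : 0 ≤ r := apply_nonneg p x
  have hs0 : 0 ≤ s := apply_nonneg p y
  have hplus : p (x + y) ≤ r + s := map_add_le_add p x y
  have hminus : p (x - y) ≤ r + s := map_sub_le_add p x y
  have hsum : (p (x + y) ^ 2 + p (x - y) ^ 2) / 2 ≤ (r + s) ^ 2 := by
    linarith [pow_le_pow_left₀ (apply_nonneg p _) hplus 2,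
      pow_le_pow_left₀ (apply_nonneg p _) hminus 2]
  rcases hs0.eq_or_lt with hs1 | hs1
  · rw [← hs1] at hsum ⊢
    simpa using hsum
  -- If `r ≤ s`, the triangle inequality suffices, as `(r + s) ^ 2 ≤ r ^ 2 + 3 * s ^ 2`.
  rcases le_or_gt r s with hrs | hrs
  · nlinarith
  have hr1 : 0 < r := hs1.trans hrs
  -- Rescaling `y` to the length `r` of `x` makes the coefficient bound homogeneous.
  obtain ⟨c, -, hc⟩ := hp x ((r / s) • y)
  have hz : p ((r / s) • y) = r := by
    rw [map_smul_eq_mul, Real.norm_of_nonneg (by positivity), ← hs, div_mul_cancel₀ _ hs1.ne']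
  have hc0 : c 0 = r ^ m := by
    have := hc 0
    simp only [zero_smul, add_zero] at this
    rw [hr, this, Finset.sum_range_succ', Finset.sum_eq_zero] <;> simp
  have hcoeff := hbound c ((2 * r) ^ m) (fun t ht => by
    rw [← hc, abs_of_nonneg (pow_nonneg (apply_nonneg p _) _)]
    refine pow_le_pow_left₀ (apply_nonneg p _) ((map_add_le_add p _ _).trans ?_) m
    rw [map_smul_eq_mul, hz, Real.norm_of_nonneg ht.1, ← hr]
    nlinarith [ht.2])
  set u := s / r with hu
  have hu0 : 0 ≤ u := by positivity
  have hu1 : u ≤ 1 := (div_le_one hr1).2 hrs.le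
  have huy : u • (r / s) • y = y := by
    rw [smul_smul, hu, div_mul_div_comm, mul_comm s r, div_self (by positivity), one_smul]
  have hpoly : (p (x + y) ^ m + p (x - y) ^ m) / 2 ≤ r ^ m * (1 + K * u ^ 2) := by
    have h1 : (p (x + y) ^ m + p (x - y) ^ m) / 2 =
        ∑ k ∈ Finset.range (m + 1), (if Even k then c k else 0) * u ^ k := by
      rw [← Finset.sum_range_mul_pow_add_neg, ← hc, ← hc, neg_smul, huy, ← sub_eq_add_neg]
    rw [h1, Finset.sum_range_succ']
    have h2 : ∀ k ∈ Finset.range m, (if Even (k + 1) then c (k + 1) else 0) * u ^ (k + 1) ≤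
        C * (2 * r) ^ m * u ^ 2 := by
      intro k hk
      have hkm : k + 1 ≤ m := Finset.mem_range.1 hk
      split_ifs with he
      · have h2k : 2 ≤ k + 1 := by
          rcases he with ⟨j, hj⟩; omega
        calc c (k + 1) * u ^ (k + 1) ≤ |c (k + 1)| * u ^ (k + 1) := by
              gcongr; exact le_abs_self _
          _ ≤ C * (2 * r) ^ m * u ^ 2 := by
              exact mul_le_mul (hcoeff _ hkm) (pow_le_pow_of_le_one hu0 hu1 h2k)
                (by positivity) (by positivity)
      · rw [zero_mul]; positivity
    have h3 := Finset.sum_le_sum h2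
    rw [Finset.sum_const, Finset.card_range, nsmul_eq_mul] at h3
    simp only [Even.zero, if_true, hc0, pow_zero, mul_one]
    calc _ ≤ m * (C * (2 * r) ^ m * u ^ 2) + r ^ m := by linarith
      _ = _ := by rw [hK, mul_pow]; ring
  obtain ⟨k, hk⟩ := hm
  have hk2 : m = 2 * k := by omega
  have hk0 : k ≠ 0 := by omega
  have hfin : ((p (x + y) ^ 2 + p (x - y) ^ 2) / 2) ^ k ≤ (r ^ 2 * (1 + K * u ^ 2)) ^ k := by
    refine (half_add_pow_le (sq_nonneg _) (sq_nonneg _) k).trans ?_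
    rw [← pow_mul, ← pow_mul, ← hk2, mul_pow, ← pow_mul, ← hk2]
    refine hpoly.trans (mul_le_mul_of_nonneg_left ?_ (by positivity))
    refine le_self_pow₀ ?_ hk0
    have : 0 ≤ K * u ^ 2 := by positivity
    linarith
  have := le_of_pow_le_pow_left₀ hk0 (by positivity) hfin
  calc _ ≤ r ^ 2 * (1 + K * u ^ 2) := this
    _ = r ^ 2 + K * s ^ 2 := by
      rw [hu]; field_simp
    _ ≤ _ := by nlinarith [sq_nonneg s]

theorem Seminorm.signAverage_sq_le_of_uniformlySmooth (p : Seminorm ℝ V) {K : ℝ}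
    (h : ∀ x y : V, (p (x + y) ^ 2 + p (x - y) ^ 2) / 2 ≤ p x ^ 2 + K * p y ^ 2)
    {n : ℕ} (x₀ : V) (x : Fin n → V) :
    signAverage (fun v => p v ^ 2) x₀ x ≤ p x₀ ^ 2 + K * ∑ i, p (x i) ^ 2 := by
  induction n generalizing x₀ with
  | zero => simp [signAverage_zero_right]
  | succ n ih =>
    rw [signAverage_succ, Fin.sum_univ_succ]
    have h1 := ih (x₀ + x 0) (Fin.tail x)
    have h2 := ih (x₀ - x 0) (Fin.tail x)
    have h3 := h x₀ (x 0)
    simp only [Fin.tail] at h1 h2 ⊢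
    linarith

theorem Seminorm.le_signAverage_pow_of_uniformlyConvex (p : Seminorm ℝ V) {δ : ℝ} {m : ℕ}
    (h : ∀ x y : V, p x ^ m + δ * p y ^ m ≤ (p (x + y) ^ m + p (x - y) ^ m) / 2)
    {n : ℕ} (x₀ : V) (x : Fin n → V) :
    p x₀ ^ m + δ * ∑ i, p (x i) ^ m ≤ signAverage (fun v => p v ^ m) x₀ x := by
  induction n generalizing x₀ with
  | zero => simp [signAverage_zero_right]
  | succ n ih =>
    rw [signAverage_succ, Fin.sum_univ_succ]
    have h1 := ih (x₀ + x 0) (Fin.tail x)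
    have h2 := ih (x₀ - x 0) (Fin.tail x)
    have h3 := h x₀ (x 0)
    simp only [Fin.tail] at h1 h2 ⊢
    linarith

theorem Seminorm.IsPolynomialPow.exists_type_two {p : Seminorm ℝ V} {m : ℕ}
    (hp : p.IsPolynomialPow m) (hm0 : 0 < m) (hm : Even m) :
    ∃ M : ℝ, ∀ (n : ℕ) (x : Fin n → V), signAverage p 0 x ≤ M * √(∑ i, p (x i) ^ 2) := by
  obtain ⟨K, hK, h⟩ := Seminorm.IsPolynomialPow.exists_uniformlySmooth (V := V) hm0 hm
  refine ⟨√K, fun n x => ?_⟩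
  rw [← Real.sqrt_mul hK.le]
  refine Real.le_sqrt_of_sq_le ((signAverage_pow_le (fun _ => apply_nonneg p _) 2 0 x).trans ?_)
  simpa using p.signAverage_sq_le_of_uniformlySmooth (h p hp) 0 x

theorem Seminorm.IsPolynomialPow.exists_cotype {p : Seminorm ℝ V} {m : ℕ}
    (hp : p.IsPolynomialPow m) (hm0 : 0 < m) (hm : Even m) :
    ∃ M : ℝ, 0 ≤ M ∧ ∀ (n : ℕ) (x : Fin n → V),
      ∑ i, p (x i) ^ m ≤ (M * signAverage p 0 x) ^ m := by
  obtain ⟨δ, hδ, h⟩ := Seminorm.IsPolynomialPow.exists_uniformlyConvex (V := V) hm0 hm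
  obtain ⟨k, hk⟩ := hm
  obtain ⟨K, hK, hKah⟩ := Seminorm.exists_signAverage_pow_le (V := V) k
  rw [two_mul, ← hk] at hKah
  refine ⟨1 + K / δ, by positivity, fun n x => ?_⟩
  have h1 := p.le_signAverage_pow_of_uniformlyConvex (h p hp) 0 x
  have h2 := h1.trans (hKah p n x)
  rw [map_zero, zero_pow hm0.ne', zero_add] at h2
  have h3 : 0 ≤ signAverage p 0 x := signAverage_nonneg (fun _ => apply_nonneg p _) _ _
  rw [mul_pow]
  calc ∑ i, p (x i) ^ m ≤ K / δ * signAverage p 0 x ^ m := by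
        rw [div_mul_eq_mul_div, le_div_iff₀ hδ]; linarith
    _ ≤ _ := by
        gcongr
        refine le_trans ?_ (le_self_pow₀ ?_ hm0.ne')
        · linarith
        · have : 0 ≤ K / δ := by positivity
          linarith

/-- Monotonicity of `ℓ_d` norms in the exponent. -/
theorem Finset.sum_pow_le_pow_of_sum_pow_le {ι : Type*} (s : Finset ι) {a : ι → ℝ} {A : ℝ}
    {d m : ℕ} (ha : ∀ i ∈ s, 0 ≤ a i) (hA : 0 ≤ A) (hd : d ≠ 0) (hdm : d ≤ m)
    (h : ∑ i ∈ s, a i ^ d ≤ A ^ d) : ∑ i ∈ s, a i ^ m ≤ A ^ m := by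
  have hle : ∀ i ∈ s, a i ≤ A := fun i hi => le_of_pow_le_pow_left₀ hd hA
    ((Finset.single_le_sum (f := fun i => a i ^ d) (fun j hj => pow_nonneg (ha j hj) d) hi).trans h)
  obtain ⟨e, rfl⟩ := Nat.exists_eq_add_of_le hdm
  calc ∑ i ∈ s, a i ^ (d + e) ≤ ∑ i ∈ s, a i ^ d * A ^ e := by
        refine Finset.sum_le_sum fun i hi => ?_
        rw [pow_add]
        exact mul_le_mul_of_nonneg_left (pow_le_pow_left₀ (ha i hi) (hle i hi) e)
          (pow_nonneg (ha i hi) d)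
    _ = (∑ i ∈ s, a i ^ d) * A ^ e := by rw [Finset.sum_mul]
    _ ≤ A ^ d * A ^ e := mul_le_mul_of_nonneg_right h (pow_nonneg hA e)
    _ = _ := (pow_add _ _ _).symm

end PolynomialPower

/-! ### From norms on subsets to seminorms on submodules -/

section Transfer

variable {V : Type*} [AddCommGroup V] [Module ℝ V] {S : Set V} {N : V → ℝ}

/-- The submodule with carrier `S`, for a normed space `(S, N)`. -/
def IsNormOn.submodule (h : IsNormOn S N) : Submodule ℝ V where
  carrier := S
  zero_mem' := h.zero_mem
  add_mem' := fun hx hy => h.add_mem _ hx _ hy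
  smul_mem' := fun c _ hx => h.smul_mem c _ hx

/-- The norm of a normed space `(S, N)` as a seminorm on the submodule `S`. -/
def IsNormOn.seminorm (h : IsNormOn S N) : Seminorm ℝ h.submodule :=
  Seminorm.of (fun v => N v) (fun x y => h.add_le _ x.2 _ y.2)
    (fun c x => by rw [Real.norm_eq_abs]; exact h.smul c _ x.2)

theorem IsNormOn.seminorm_apply (h : IsNormOn S N) (v : h.submodule) :
    h.seminorm v = N v := rfl

theorem IsNormOn.rademacherAverage_eq (h : IsNormOn S N) {n : ℕ} (x : Fin n → h.submodule) :
    rademacherAverage N (fun i => (x i : V)) = signAverage h.seminorm 0 x := by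
  simp only [rademacherAverage, signAverage, h.seminorm_apply, zero_add,
    AddSubmonoidClass.coe_finsetSum, SetLike.val_smul]

theorem IsNormOn.hasTypeOn_two (h : IsNormOn S N) {d : ℕ} (hd0 : 0 < d) (hd : Even d)
    (hp : h.seminorm.IsPolynomialPow d) : HasTypeOn S N 2 := by
  obtain ⟨M, hM⟩ := hp.exists_type_two hd0 hd
  refine ⟨M, fun n x hx => ?_⟩
  have := hM n fun i => ⟨x i, hx i⟩
  rw [← h.rademacherAverage_eq, Real.sqrt_eq_rpow] at this
  simpa [h.seminorm_apply] using this

/-- The exponent `m` is allowed to exceed the degree `d`, since cotype `d` implies cotype `m`. -/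
theorem IsNormOn.hasCotypeOn (h : IsNormOn S N) {d m : ℕ} (hd0 : 0 < d) (hd : Even d)
    (hdm : d ≤ m) (hp : h.seminorm.IsPolynomialPow d) : HasCotypeOn S N m := by
  obtain ⟨M, hM0, hM⟩ := hp.exists_cotype hd0 hd
  refine ⟨M, fun n x hx => ?_⟩
  set z : Fin n → h.submodule := fun i => ⟨x i, hx i⟩ with hz
  have h0 : 0 ≤ M * signAverage h.seminorm 0 z :=
    mul_nonneg hM0 (signAverage_nonneg (fun _ => apply_nonneg _ _) _ _)
  have h1 := Finset.sum_pow_le_pow_of_sum_pow_le Finset.univ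
    (fun i _ => apply_nonneg h.seminorm (z i)) h0 hd0.ne' hdm (hM n z)
  rw [← h.rademacherAverage_eq] at h0 h1
  have hm0 : m ≠ 0 := by omega
  have h2 := Real.rpow_le_rpow (Finset.sum_nonneg fun i _ =>
    pow_nonneg (apply_nonneg h.seminorm (z i)) m) h1 (by positivity : (0 : ℝ) ≤ 1 / m)
  rw [one_div, Real.pow_rpow_inv_natCast h0 hm0] at h2
  simpa [h.seminorm_apply] using h2

end Transfer

namespace BipartiteGraph

/-! ### The polynomial `h_H` along lines -/

section Polynomial

variable {X Y E I J : Type*} [Fintype E] (H : BipartiteGraph X Y E)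

theorem abs_homTerm (w : I → J → ℝ) (p : (X → I) × (Y → J)) :
    |H.homTerm w p| = H.homTerm |w| p := by
  simp only [homTerm, Finset.abs_prod, Pi.abs_apply]

variable {H} in
theorem abs_mem_space {w : I → J → ℝ} (hw : w ∈ H.space I J) : |w| ∈ H.space I J := by
  have : Summable (H.homTerm w) := hw
  exact this.abs.congr fun p => (H.abs_homTerm w p)

theorem hom_abs_nonneg (w : I → J → ℝ) : 0 ≤ H.hom |w| :=
  tsum_nonneg fun p => H.abs_homTerm w p ▸ abs_nonneg _

theorem hom_neg (w : I → J → ℝ) : H.hom (-w) = (-1) ^ Fintype.card E * H.hom w := by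
  rw [hom, hom, ← tsum_mul_left]
  refine tsum_congr fun p => ?_
  simp only [homTerm, Pi.neg_apply, Finset.prod_neg, Finset.card_univ]

open Classical in
/-- The term of the sum for an assignment `p` in which the edges in `T` carry `y` and the other
edges carry `x`. -/
noncomputable def mixedTerm (x y : I → J → ℝ) (T : Finset E) (p : (X → I) × (Y → J)) : ℝ :=
  (∏ e ∈ T, y (p.1 (H.src e)) (p.2 (H.tgt e))) * ∏ e ∈ Tᶜ, x (p.1 (H.src e)) (p.2 (H.tgt e))

theorem homTerm_add_smul (x y : I → J → ℝ) (t : ℝ) (p : (X → I) × (Y → J)) :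
    H.homTerm (x + t • y) p = ∑ k ∈ Finset.range (Fintype.card E + 1),
      ∑ T ∈ Finset.powersetCard k (Finset.univ : Finset E), H.mixedTerm x y T p * t ^ k := by
  classical
  simp only [homTerm, Pi.add_apply, Pi.smul_apply, smul_eq_mul]
  simp_rw [add_comm (x _ _)]
  rw [Finset.prod_add, Finset.sum_powerset, Finset.card_univ]
  refine Finset.sum_congr rfl fun k _ => Finset.sum_congr rfl fun T hT => ?_
  rw [Finset.prod_mul_distrib, Finset.prod_const, (Finset.mem_powersetCard.1 hT).2, mixedTerm,
    Finset.compl_eq_univ_sdiff]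
  ring

theorem abs_mixedTerm_le (x y : I → J → ℝ) (T : Finset E) (p : (X → I) × (Y → J)) :
    |H.mixedTerm x y T p| ≤ H.homTerm (|x| + |y|) p := by
  classical
  rw [mixedTerm, homTerm, abs_mul, Finset.abs_prod, Finset.abs_prod,
    ← Finset.prod_mul_prod_compl T]
  refine mul_le_mul ?_ ?_ (Finset.prod_nonneg fun _ _ => abs_nonneg _)
    (Finset.prod_nonneg fun _ _ => add_nonneg (abs_nonneg _) (abs_nonneg _))
  · exact Finset.prod_le_prod (fun _ _ => abs_nonneg _) fun _ _ =>
      le_add_of_nonneg_left (abs_nonneg _)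
  · exact Finset.prod_le_prod (fun _ _ => abs_nonneg _) fun _ _ =>
      le_add_of_nonneg_right (abs_nonneg _)

theorem exists_hom_add_smul_eq {x y : I → J → ℝ} (hxy : |x| + |y| ∈ H.space I J) :
    ∃ c : ℕ → ℝ, c (Fintype.card E) = H.hom y ∧ ∀ t : ℝ,
      H.hom (x + t • y) = ∑ k ∈ Finset.range (Fintype.card E + 1), c k * t ^ k := by
  have hs : ∀ T, Summable (H.mixedTerm x y T) := fun T =>
    Summable.of_norm_bounded hxy (H.abs_mixedTerm_le x y T)
  refine ⟨fun k => ∑ T ∈ Finset.powersetCard k (Finset.univ : Finset E),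
    ∑' p, H.mixedTerm x y T p, ?_, fun t => ?_⟩
  · simp only [← Finset.card_univ]
    rw [Finset.powersetCard_self, Finset.sum_singleton, hom]
    refine tsum_congr fun p => ?_
    simp [mixedTerm, homTerm]
  · rw [hom]
    simp_rw [homTerm_add_smul]
    rw [Summable.tsum_finsetSum fun k _ => summable_sum fun T _ => (hs T).mul_right _]
    refine Finset.sum_congr rfl fun k _ => ?_
    rw [Summable.tsum_finsetSum fun T _ => (hs T).mul_right _, Finset.sum_mul]
    exact Finset.sum_congr rfl fun T _ => tsum_mul_right

end Polynomial

/-! ### The sign of `h_H` when the graph norm is a norm -/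

section Norm

variable {X Y E I J : Type*} [Fintype E] {H : BipartiteGraph X Y E}

theorem graphNorm_pow_card (hE : Fintype.card E ≠ 0) (w : I → J → ℝ) :
    H.graphNorm w ^ Fintype.card E = |H.hom w| := by
  rw [graphNorm, one_div, Real.rpow_inv_natCast_pow (abs_nonneg _) hE]

theorem eq_zero_of_hom_eq_zero (hE : Fintype.card E ≠ 0)
    (hnorm : IsNormOn (H.space I J) H.graphNorm) {w : I → J → ℝ} (hw : w ∈ H.space I J)
    (h : H.hom w = 0) : w = 0 := by
  refine (hnorm.eq_zero_iff w hw).1 (eq_zero_of_pow_eq_zero (n := Fintype.card E) ?_)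
  rw [graphNorm_pow_card hE, h, abs_zero]

/-- A segment along which `h_H` changes sign contains a zero of `h_H`, which can only be the zero
matrix. -/
theorem exists_segment_eq_zero (hE : Fintype.card E ≠ 0)
    (hnorm : IsNormOn (H.space I J) H.graphNorm) {x y : I → J → ℝ} (hx : x ∈ H.space I J)
    (hy : y ∈ H.space I J) (hx0 : H.hom x ≤ 0) (hy0 : 0 ≤ H.hom y) :
    ∃ t ∈ Set.Icc (0 : ℝ) 1, x + t • (y - x) = 0 := by
  have hd : y - x ∈ H.space I J := by
    rw [sub_eq_add_neg, ← neg_one_smul ℝ]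
    exact hnorm.add_mem _ hy _ (hnorm.smul_mem _ _ hx)
  obtain ⟨c, -, hc⟩ := H.exists_hom_add_smul_eq
    (hnorm.add_mem _ (abs_mem_space hx) _ (abs_mem_space hd))
  have hcont : Continuous fun t : ℝ => H.hom (x + t • (y - x)) := by
    simp_rw [hc]
    fun_prop
  have h := intermediate_value_Icc zero_le_one hcont.continuousOn
  simp only [zero_smul, add_zero, one_smul, add_sub_cancel] at h
  obtain ⟨t, ht, h0⟩ := h ⟨hx0, hy0⟩
  exact ⟨t, ht, eq_zero_of_hom_eq_zero hE hnorm
    (hnorm.add_mem _ hx _ (hnorm.smul_mem _ _ hd)) h0⟩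

theorem hom_nonneg_of_even (hE : Fintype.card E ≠ 0) (hev : Even (Fintype.card E))
    (hnorm : IsNormOn (H.space I J) H.graphNorm) {w : I → J → ℝ} (hw : w ∈ H.space I J) :
    0 ≤ H.hom w := by
  by_contra! hneg
  obtain ⟨t, ⟨ht0, ht1⟩, h⟩ := exists_segment_eq_zero hE hnorm hw (abs_mem_space hw) hneg.le
    (H.hom_abs_nonneg w)
  -- At an entry with `w i j > 0` the segment from `w` to `|w|` is constant and nonzero.
  have hle : w = -|w| := by
    ext i j
    have hij : w i j + t * (|w i j| - w i j) = 0 := congrFun (congrFun h i) j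
    have : w i j ≤ 0 := by
      by_contra! hpos
      rw [abs_of_pos hpos] at hij
      linarith
    simp only [Pi.neg_apply, Pi.abs_apply, abs_of_nonpos this, neg_neg]
  have := H.hom_abs_nonneg w
  rw [hle, hom_neg, hev.neg_one_pow, one_mul] at hneg
  linarith

/-- For an odd number of edges `W_H` is at most one-dimensional. This does occur, for instance if
`I` and `J` are singletons. -/
theorem exists_eq_smul_of_odd (hodd : Odd (Fintype.card E))
    (hnorm : IsNormOn (H.space I J) H.graphNorm) {x y : I → J → ℝ} (hx : x ∈ H.space I J)
    (hy : y ∈ H.space I J) (hy0 : y ≠ 0) : ∃ s : ℝ, x = s • y := by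
  have hE : Fintype.card E ≠ 0 := hodd.pos.ne'
  have key : ∀ z ∈ H.space I J, ∀ z' ∈ H.space I J, z' ≠ 0 → H.hom z ≤ 0 → 0 ≤ H.hom z' →
      ∃ s : ℝ, z = s • z' := by
    intro z hz z' hz' hz'0 h1 h2
    obtain ⟨t, -, ht⟩ := exists_segment_eq_zero hE hnorm hz hz' h1 h2
    have ht1 : 1 - t ≠ 0 := by
      intro h
      have : t = 1 := by linarith
      rw [this, one_smul, add_sub_cancel] at ht
      exact hz'0 ht
    refine ⟨-t / (1 - t), ?_⟩
    have h3 : (1 - t) • z = (-t) • z' := by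
      rw [← sub_eq_zero, ← ht]; module
    rw [div_eq_inv_mul, mul_smul, ← h3, smul_smul, inv_mul_cancel₀ ht1, one_smul]
  have hneg : ∀ z ∈ H.space I J, -z ∈ H.space I J := fun z hz => by
    rw [← neg_one_smul ℝ]; exact hnorm.smul_mem _ _ hz
  have hhn : ∀ z : I → J → ℝ, H.hom (-z) = -H.hom z := fun z => by
    rw [hom_neg, hodd.neg_one_pow, neg_one_mul]
  have key' : ∀ z ∈ H.space I J, H.hom z ≤ 0 → ∃ s : ℝ, z = s • y := by
    intro z hz h1
    rcases le_total 0 (H.hom y) with h2 | h2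
    · exact key z hz y hy hy0 h1 h2
    · obtain ⟨s, hs⟩ := key z hz (-y) (hneg y hy) (neg_ne_zero.2 hy0) h1 (by rw [hhn]; linarith)
      exact ⟨-s, by rw [hs, smul_neg, neg_smul]⟩
  rcases le_total (H.hom x) 0 with h | h
  · exact key' x hx h
  · obtain ⟨s, hs⟩ := key' (-x) (hneg x hx) (by rw [hhn]; linarith)
    exact ⟨-s, by rw [neg_smul, ← hs, neg_neg]⟩

theorem isPolynomialPow_of_even (hE : Fintype.card E ≠ 0) (hev : Even (Fintype.card E))
    (hnorm : IsNormOn (H.space I J) H.graphNorm) :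
    hnorm.seminorm.IsPolynomialPow (Fintype.card E) := by
  intro x y
  have hpow : ∀ v : hnorm.submodule, hnorm.seminorm v ^ Fintype.card E =
      H.hom (v : I → J → ℝ) := fun v => by
    rw [hnorm.seminorm_apply, graphNorm_pow_card hE,
      abs_of_nonneg (hom_nonneg_of_even hE hev hnorm v.2)]
  obtain ⟨c, hcm, hc⟩ := H.exists_hom_add_smul_eq
    (hnorm.add_mem _ (abs_mem_space x.2) _ (abs_mem_space y.2))
  exact ⟨c, by rw [hcm, hpow], fun t => by rw [hpow, ← hc]; rfl⟩

theorem isPolynomialPow_two_of_odd (hodd : Odd (Fintype.card E))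
    (hnorm : IsNormOn (H.space I J) H.graphNorm) : hnorm.seminorm.IsPolynomialPow 2 := by
  intro x y
  rcases eq_or_ne y 0 with rfl | hy
  · exact ⟨fun k => if k = 0 then hnorm.seminorm x ^ 2 else 0, by simp, fun t => by simp⟩
  obtain ⟨s, hs⟩ := exists_eq_smul_of_odd hodd hnorm x.2 y.2 fun h => hy (Subtype.ext h)
  have hxs : x = s • y := Subtype.ext hs
  refine ⟨fun k => if k = 0 then s ^ 2 * hnorm.seminorm y ^ 2 else
    if k = 1 then 2 * s * hnorm.seminorm y ^ 2 else hnorm.seminorm y ^ 2, by simp, fun t => ?_⟩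
  rw [hxs, ← add_smul, map_smul_eq_mul, mul_pow, Real.norm_eq_abs, sq_abs]
  simp [Finset.sum_range_succ]
  ring

end Norm

/-! ### Diagonal matrices and the failure of smaller cotypes -/

section Diagonal

variable {X Y E I J : Type*} [Fintype E] {H : BipartiteGraph X Y E}

open Classical in
/-- The matrix with entry `c k` at position `(a k, b k)` and zeros elsewhere, for injective `a`. -/
noncomputable def diagonal {n : ℕ} (a : Fin n → I) (b : Fin n → J) (c : Fin n → ℝ) :
    I → J → ℝ :=
  fun i j => ∑ k, if i = a k ∧ j = b k then c k else 0

theorem diagonal_apply {n : ℕ} {a : Fin n → I} {b : Fin n → J} (ha : a.Injective)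
    (c : Fin n → ℝ) (k : Fin n) : diagonal a b c (a k) (b k) = c k := by
  rw [diagonal, Finset.sum_eq_single k]
  · simp
  · intro l _ hl
    rw [if_neg]
    exact fun h => hl (ha h.1.symm)
  · simp

theorem exists_of_diagonal_ne_zero {n : ℕ} {a : Fin n → I} {b : Fin n → J} {c : Fin n → ℝ}
    {i : I} {j : J} (h : diagonal a b c i j ≠ 0) : ∃ k, i = a k ∧ j = b k := by
  obtain ⟨k, -, hk⟩ := Finset.exists_ne_zero_of_sum_ne_zero h
  exact ⟨k, by by_contra h'; exact hk (if_neg h')⟩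

theorem sum_smul_diagonal_single {n : ℕ} (a : Fin n → I) (b : Fin n → J) (c : Fin n → ℝ) :
    ∑ k, c k • diagonal a b (Pi.single k 1) = diagonal a b c := by
  classical
  ext i j
  simp only [Finset.sum_apply, Pi.smul_apply, smul_eq_mul, diagonal, Finset.mul_sum]
  rw [Finset.sum_comm]
  refine Finset.sum_congr rfl fun l _ => ?_
  rw [Finset.sum_eq_single l]
  · split_ifs <;> simp
  · intro k _ hk
    simp [hk.symm]
  · simp

/-- For connected `H` only constant assignments contribute to `h_H` of a diagonal matrix: a nonzero
factor forces the two ends of its edge to carry the same index. -/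
theorem exists_const_of_homTerm_diagonal_ne_zero [Nonempty E] (hH : H.IsConnected) {n : ℕ}
    {a : Fin n → I} {b : Fin n → J} (ha : a.Injective) (hb : b.Injective) {c : Fin n → ℝ}
    {p : (X → I) × (Y → J)} (h : H.homTerm (diagonal a b c) p ≠ 0) :
    ∃ k, (fun _ => a k, fun _ => b k) = p := by
  have hedge : ∀ e, ∃ k, p.1 (H.src e) = a k ∧ p.2 (H.tgt e) = b k := fun e =>
    exists_of_diagonal_ne_zero (Finset.prod_ne_zero_iff.1 h e (Finset.mem_univ e))
  obtain ⟨e₀⟩ := ‹Nonempty E›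
  obtain ⟨k, hk, -⟩ := hedge e₀
  set L : X ⊕ Y → Prop := Sum.elim (fun x => p.1 x = a k) (fun y => p.2 y = b k) with hL
  have hst : ∀ e, L (Sum.inl (H.src e)) ↔ L (Sum.inr (H.tgt e)) := by
    intro e
    obtain ⟨l, h1, h2⟩ := hedge e
    simp only [hL, Sum.elim_inl, Sum.elim_inr, h1, h2, ha.eq_iff, hb.eq_iff]
  have hadj : ∀ u v, H.toSimpleGraph.Adj u v → L u → L v := by
    rintro u v ⟨-, ⟨e, rfl, rfl⟩ | ⟨e, rfl, rfl⟩⟩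
    · exact (hst e).1
    · exact (hst e).2
  have hall : ∀ v, L v := by
    intro v
    obtain ⟨w⟩ := hH.preconnected (Sum.inl (H.src e₀)) v
    have : ∀ u v, H.toSimpleGraph.Walk u v → L u → L v := by
      intro u v w
      induction w with
      | nil => exact id
      | cons h _ ih => exact fun hu => ih (hadj _ _ h hu)
    exact this _ _ w hk
  exact ⟨k, Prod.ext (funext fun x => (hall (Sum.inl x)).symm)
    (funext fun y => (hall (Sum.inr y)).symm)⟩

theorem hasSum_homTerm_diagonal [Nonempty E] (hH : H.IsConnected) {n : ℕ} {a : Fin n → I}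
    {b : Fin n → J} (ha : a.Injective) (hb : b.Injective) (c : Fin n → ℝ) :
    HasSum (H.homTerm (diagonal a b c)) (∑ k, c k ^ Fintype.card E) := by
  set g : Fin n → (X → I) × (Y → J) := fun k => (fun _ => a k, fun _ => b k) with hg
  have hinj : g.Injective := by
    intro k l hkl
    exact ha (congrFun (congrArg Prod.fst hkl) (H.src (Classical.arbitrary E)))
  rw [← hinj.hasSum_iff]
  · convert hasSum_fintype (H.homTerm (diagonal a b c) ∘ g) using 2 with k
    simp [hg, homTerm, diagonal_apply ha]
  · intro p hp
    by_contra h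
    exact hp (exists_const_of_homTerm_diagonal_ne_zero hH ha hb h)

theorem not_hasCotypeOn_of_lt (hH : H.IsConnected) [Infinite I] [Infinite J] {q : ℝ}
    (hq : 0 < q) (hqm : q < Fintype.card E) : ¬ HasCotypeOn (H.space I J) H.graphNorm q := by
  rintro ⟨M, hM⟩
  set m := Fintype.card E with hm
  have hmpos : (0 : ℝ) < m := hq.trans hqm
  have : Nonempty E := Fintype.card_pos_iff.1 (by exact_mod_cast hmpos)
  have hm0 : m ≠ 0 := Fintype.card_ne_zero
  have hbound : ∀ n : ℕ, (n : ℝ) ^ (1 / q) ≤ |M| * (n : ℝ) ^ (1 / (m : ℝ)) := by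
    intro n
    set a : Fin n → I := fun k => Infinite.natEmbedding I k
    set b : Fin n → J := fun k => Infinite.natEmbedding J k
    have ha : a.Injective := fun k l h => Fin.ext ((Infinite.natEmbedding I).injective h)
    have hb : b.Injective := fun k l h => Fin.ext ((Infinite.natEmbedding J).injective h)
    have hsum := hasSum_homTerm_diagonal (H := H) hH ha hb
    have hN : ∀ c : Fin n → ℝ,
        H.graphNorm (diagonal a b c) = |∑ k, c k ^ m| ^ (1 / (m : ℝ)) := fun c => by
      rw [graphNorm, hom, (hsum c).tsum_eq]
    have hone : ∀ k : Fin n, H.graphNorm (diagonal a b (Pi.single k 1)) = 1 := by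
      intro k
      rw [hN, Finset.sum_eq_single k]
      · simp
      · intro l _ hl
        simp [hl, hm0]
      · simp
    have h := hM n (fun k => diagonal a b (Pi.single k 1)) fun k => (hsum _).summable
    simp only [hone, Real.one_rpow, Finset.sum_const, Finset.card_univ, Fintype.card_fin,
      nsmul_eq_mul, mul_one] at h
    have hR0 : 0 ≤ rademacherAverage H.graphNorm fun k => diagonal a b (Pi.single k 1) :=
      div_nonneg (Finset.sum_nonneg fun ε _ => Real.rpow_nonneg (abs_nonneg _) _) (by positivity)
    have hR : rademacherAverage H.graphNorm (fun k => diagonal a b (Pi.single k 1)) ≤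
        (n : ℝ) ^ (1 / (m : ℝ)) := by
      rw [rademacherAverage, div_le_iff₀ (by positivity)]
      refine (Finset.sum_le_card_nsmul _ _ ((n : ℝ) ^ (1 / (m : ℝ))) fun ε _ => ?_).trans_eq ?_
      · rw [sum_smul_diagonal_single a b fun k => if ε k then (1 : ℝ) else -1, hN]
        refine Real.rpow_le_rpow (abs_nonneg _) ?_ (by positivity)
        refine (Finset.abs_sum_le_sum_abs _ _).trans ?_
        refine (Finset.sum_le_card_nsmul _ _ 1 fun k _ => ?_).trans_eq (by simp)
        split_ifs <;> simp
      · simp [mul_comm]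
    exact h.trans (mul_le_mul (le_abs_self M) hR hR0 (abs_nonneg M))
  have hexp : 0 < 1 / q - 1 / (m : ℝ) := sub_pos.2 (one_div_lt_one_div_of_lt hq hqm)
  have htends := (tendsto_rpow_atTop hexp).comp tendsto_natCast_atTop_atTop
  obtain ⟨n, hn, hn1⟩ := ((htends.eventually_gt_atTop |M|).and
    (Filter.eventually_gt_atTop 0)).exists
  have hn0 : (0 : ℝ) < n := by exact_mod_cast hn1
  simp only [Function.comp_apply, Real.rpow_sub hn0] at hn
  rw [lt_div_iff₀ (by positivity)] at hn
  exact absurd (hbound n) (not_le.2 hn)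

end Diagonal

end BipartiteGraph

theorem mainTheorem6 {X Y E I J : Type*} [Fintype X] [Fintype Y] [Fintype E]
    (H : BipartiteGraph X Y E) (hm : 2 ≤ Fintype.card E)
    (hnorm : IsNormOn (H.space I J) H.graphNorm) :
    HasTypeOn (H.space I J) H.graphNorm 2 ∧
    HasCotypeOn (H.space I J) H.graphNorm (Fintype.card E : ℝ) ∧
    (H.IsConnected → Infinite I → Infinite J →
      ∀ q : ℝ, 0 < q → q < (Fintype.card E : ℝ) →
        ¬ HasCotypeOn (H.space I J) H.graphNorm q) := by
  have hthird : H.IsConnected → Infinite I → Infinite J → ∀ q : ℝ, 0 < q →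
      q < (Fintype.card E : ℝ) → ¬ HasCotypeOn (H.space I J) H.graphNorm q :=
    fun hH _ _ q hq hqm => BipartiteGraph.not_hasCotypeOn_of_lt hH hq hqm
  rcases Nat.even_or_odd (Fintype.card E) with hev | hodd
  · have hp := BipartiteGraph.isPolynomialPow_of_even (by omega) hev hnorm
    exact ⟨hnorm.hasTypeOn_two (by omega) hev hp, hnorm.hasCotypeOn (by omega) hev le_rfl hp,
      hthird⟩
  · have hp := BipartiteGraph.isPolynomialPow_two_of_odd hodd hnorm
    exact ⟨hnorm.hasTypeOn_two two_pos even_two hp, hnorm.hasCotypeOn two_pos even_two hm hp,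
      hthird⟩
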